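/- Let $q\ge 4$ be a prime power, let $n=q^2-1$, and let $\mathbb F_q$ be the field with $q$ elements. Then there exists a convolutional code over $\mathbb F_q$ with parameters $(n,\,n-2q+1,\,1;\,1,\,d_{\mathrm{free}}\ge q+2)_q$. Here a matrix $G(D)=(g_{ij})\in\mathbb F_q[D]^{k\times n}$ is called basic if it has a polynomial right inverse. With $\gamma_i=\max_{j}\deg g_{ij}$, a basic matrix is called reduced if $\gamma_1+\cdots+\gamma_k$ is smallest among all basic matrices generating the same code. A convolutional code with parameters $(n,k,\gamma;\mu,d_{\mathrm{free}})_q$ is a submodule $C=\{\mathbf u(D)G(D):\mathbf u(D)\in\mathbb F_q[D]^k\}$ of $\mathbb F_q[D]^n$ generated by a reduced basic matrix $G(D)\in\mathbb F_q[D]^{k\times n}$ with $\gamma=\sum_{i=1}^k\gamma_i$ and $\mu=\max_{1\le i\le k}\gamma_i$. The number $d_{\mathrm{free}}$ is the minimum of $\mathrm{wt}(\mathbf v(D))$ over all nonzero $\mathbf v(D)\in C$, where $\mathrm{wt}(\mathbf v(D))$ is the total number of nonzero coefficients of the $n$ components of $\mathbf v(D)$. -/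

import Mathlib

namespace ConvCode

variable {F : Type*} [Field F] {k n : ℕ}

/-- The code `{u(D) G(D) | u(D) ∈ F[D]^k}` generated by a polynomial matrix `G(D)`,
a submodule of `F[D]^n`. -/
noncomputable def generatedCode (G : Matrix (Fin k) (Fin n) (Polynomial F)) :
    Submodule (Polynomial F) (Fin n → Polynomial F) :=
  LinearMap.range G.vecMulLinear

/-- The `i`-th constraint length `γ_i`: the largest degree of an entry of the `i`-th row. -/
noncomputable def rowDegree (G : Matrix (Fin k) (Fin n) (Polynomial F)) (i : Fin k) : ℕ :=
  Finset.univ.sup fun j => (G i j).natDegree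

/-- The overall constraint length `γ_1 + ⋯ + γ_k`. -/
noncomputable def constraintLength (G : Matrix (Fin k) (Fin n) (Polynomial F)) : ℕ :=
  ∑ i, rowDegree G i

/-- The memory `max γ_i`. -/
noncomputable def memory (G : Matrix (Fin k) (Fin n) (Polynomial F)) : ℕ :=
  Finset.univ.sup fun i => rowDegree G i

/-- A polynomial matrix is basic if it has a polynomial right inverse. -/
def IsBasic (G : Matrix (Fin k) (Fin n) (Polynomial F)) : Prop :=
  ∃ K : Matrix (Fin n) (Fin k) (Polynomial F), G * K = 1

/-- A basic matrix is reduced if its overall constraint length is smallest among all basic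
generator matrices of the code that it generates. -/
def IsReducedBasic (G : Matrix (Fin k) (Fin n) (Polynomial F)) : Prop :=
  IsBasic G ∧ ∀ G' : Matrix (Fin k) (Fin n) (Polynomial F),
    IsBasic G' → generatedCode G' = generatedCode G → constraintLength G ≤ constraintLength G'

/-- The Hamming weight of `v(D) = ∑ v_i D^i`, which is `∑ wt(v_i)`: the total number of nonzero
coefficients of the components of `v(D)`. -/
def weight (v : Fin n → Polynomial F) : ℕ :=
  ∑ j, (v j).support.card

/-- The free distance: the least weight of a nonzero codeword
(the value is `0` for the zero code, which has no nonzero codeword). -/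
noncomputable def freeDistance (C : Submodule (Polynomial F) (Fin n → Polynomial F)) : ℕ :=
  sInf {w | ∃ v ∈ C, v ≠ 0 ∧ weight v = w}

/-- `C` is a convolutional code of length `n` with parameters `(n, k, γ; μ, d)`. -/
def HasParameters (C : Submodule (Polynomial F) (Fin n → Polynomial F)) (k γ μ d : ℕ) : Prop :=
  (∃ G : Matrix (Fin k) (Fin n) (Polynomial F),
    IsReducedBasic G ∧ generatedCode G = C ∧ constraintLength G = γ ∧ memory G = μ) ∧
  freeDistance C = d

end ConvCode

/-! Take the BCH code whose locators are the `n` units of the field `K` with `q ^ 2` elements, with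
syndromes at exponents `0, …, q - 1`. Frobenius gives exponent `q` for free, so the distance is at
least `q + 2`; exponent `0` costs one dimension over `F`, the others two each, so `n - 2q + 1`
dimensions remain. Let `G₀` have that many independent codewords as rows, with right inverse `K₀`,
and add `w D` to one row, where `w ≠ 0` and `w K₀ = 0`. Then `K₀` is still a right inverse, and the
lowest coefficient of a nonzero codeword is a nonzero BCH word. -/

namespace ConvCode

open Polynomial

/-! ### From block codes to convolutional codes of degree one -/

section Construction

variable {F : Type*} [Field F] {k n : ℕ}

/-- The polynomial matrix whose rows are those of a constant matrix `G₀`, with `w D` added to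
the row `i₀`. -/
noncomputable def perturbedMatrix (G₀ : Matrix (Fin k) (Fin n) F) (w : Fin n → F) (i₀ : Fin k) :
    Matrix (Fin k) (Fin n) F[X] :=
  Matrix.of fun i j => C (G₀ i j) + if i = i₀ then C (w j) * X else 0

theorem vecMul_perturbedMatrix_apply (G₀ : Matrix (Fin k) (Fin n) F) (w : Fin n → F) (i₀ : Fin k)
    (u : Fin k → F[X]) (j : Fin n) :
    Matrix.vecMul u (perturbedMatrix G₀ w i₀) j =
      ∑ i, u i * C (G₀ i j) + u i₀ * C (w j) * X := by
  simp [Matrix.vecMul, dotProduct, perturbedMatrix, mul_add, Finset.sum_add_distrib, mul_assoc]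

theorem perturbedMatrix_mul_map {G₀ : Matrix (Fin k) (Fin n) F} {w : Fin n → F} (i₀ : Fin k)
    {K₀ : Matrix (Fin n) (Fin k) F} (hK : G₀ * K₀ = 1) (hw : Matrix.vecMul w K₀ = 0) :
    perturbedMatrix G₀ w i₀ * K₀.map C = 1 := by
  ext1 i l
  have h1 : ∑ j, C (G₀ i j) * C (K₀ j l) = (1 : Matrix (Fin k) (Fin k) F[X]) i l := by
    have := congrArg C (congrFun (congrFun hK i) l)
    simpa [Matrix.mul_apply, map_sum, Matrix.one_apply, apply_ite C] using this
  have h2 : ∑ j, C (w j) * C (K₀ j l) = (0 : F[X]) := by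
    have := congrArg C (congrFun hw l)
    simpa [Matrix.vecMul, dotProduct, map_sum] using this
  by_cases hi : i = i₀
  · have h3 : ∑ j, C (w j) * X * C (K₀ j l) = (∑ j, C (w j) * C (K₀ j l)) * X := by
      rw [Finset.sum_mul]
      exact Finset.sum_congr rfl fun j _ => by ring
    rw [← h1]
    simp only [Matrix.mul_apply, perturbedMatrix, Matrix.of_apply, Matrix.map_apply, if_pos hi,
      add_mul, Finset.sum_add_distrib, h3, h2, zero_mul, add_zero]
  · simp only [Matrix.mul_apply, perturbedMatrix, Matrix.of_apply, Matrix.map_apply, if_neg hi,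
      add_zero, h1]

theorem rowDegree_perturbedMatrix {G₀ : Matrix (Fin k) (Fin n) F} {w : Fin n → F} (hw : w ≠ 0)
    (i₀ i : Fin k) : rowDegree (perturbedMatrix G₀ w i₀) i = if i = i₀ then 1 else 0 := by
  by_cases hi : i = i₀
  · rw [if_pos hi]
    obtain ⟨j, hj⟩ := Function.ne_iff.mp hw
    have hdeg (j : Fin n) :
        perturbedMatrix G₀ w i₀ i j = C (w j) * X + C (G₀ i j) := by
      simp [perturbedMatrix, hi, add_comm]
    apply le_antisymm
    · exact Finset.sup_le fun j _ => by rw [hdeg]; exact natDegree_linear_le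
    · refine le_trans ?_ (Finset.le_sup (Finset.mem_univ j))
      rw [hdeg, natDegree_linear hj]
  · rw [if_neg hi, ← Nat.le_zero]
    exact Finset.sup_le fun j _ => by simp [perturbedMatrix, hi]

/-- The code generated by a constant matrix contains the coefficient vectors of its elements. -/
theorem coeff_mem_generatedCode {G : Matrix (Fin k) (Fin n) F[X]}
    (hG : constraintLength G = 0) {v : Fin n → F[X]} (hv : v ∈ generatedCode G) (s : ℕ) :
    (fun j => C ((v j).coeff s)) ∈ generatedCode G := by
  obtain ⟨u, rfl⟩ := hv
  have hconst (i : Fin k) (j : Fin n) : ∃ a : F, C a = G i j := by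
    have hi : rowDegree G i = 0 := Finset.sum_eq_zero_iff.mp hG i (Finset.mem_univ i)
    have hij : (G i j).natDegree ≤ rowDegree G i :=
      Finset.le_sup (f := fun j => (G i j).natDegree) (Finset.mem_univ j)
    exact natDegree_eq_zero.mp (by omega)
  choose a ha using hconst
  refine ⟨fun i => C ((u i).coeff s), ?_⟩
  funext j
  simp [Matrix.vecMul, dotProduct, ← ha, map_sum]

/-- A smaller generator matrix would be constant, so its code would contain `w`, a coefficient of a
row. But `w = u G` forces `u = w K₀ = 0`. -/
theorem isReducedBasic_perturbedMatrix {G₀ : Matrix (Fin k) (Fin n) F} {w : Fin n → F}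
    (hw0 : w ≠ 0) (i₀ : Fin k) {K₀ : Matrix (Fin n) (Fin k) F} (hK : G₀ * K₀ = 1)
    (hw : Matrix.vecMul w K₀ = 0) : IsReducedBasic (perturbedMatrix G₀ w i₀) := by
  have hright := perturbedMatrix_mul_map i₀ hK hw
  refine ⟨⟨_, hright⟩, fun G' _ hcode => ?_⟩
  have hlen : constraintLength (perturbedMatrix G₀ w i₀) = 1 := by
    simp [constraintLength, rowDegree_perturbedMatrix hw0]
  rw [hlen, Nat.one_le_iff_ne_zero]
  intro hzero
  have hrow : Matrix.vecMul (Pi.single i₀ 1) (perturbedMatrix G₀ w i₀) ∈ generatedCode G' := by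
    rw [hcode]
    exact ⟨_, rfl⟩
  obtain ⟨u, hu⟩ := hcode ▸ coeff_mem_generatedCode hzero hrow 1
  have hwC : Matrix.vecMul u (perturbedMatrix G₀ w i₀) = fun j => C (w j) := by
    rw [← Matrix.vecMulLinear_apply, hu]
    funext j
    simp [perturbedMatrix, coeff_C]
  have hu0 : u = 0 := by
    rw [← Matrix.vecMul_one u, ← hright, ← Matrix.vecMul_vecMul, hwC]
    funext l
    have := congrArg C (congrFun hw l)
    simpa [Matrix.vecMul, dotProduct, map_sum] using this
  apply hw0
  funext j
  have := congrFun hwC j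
  simpa [hu0] using this.symm

/-- The lowest nonzero coefficient of a codeword is a nonzero word of the code generated by
`G₀`. -/
theorem le_weight_vecMul_perturbedMatrix [DecidableEq F] {G₀ : Matrix (Fin k) (Fin n) F}
    {w : Fin n → F} {i₀ : Fin k} {d : ℕ}
    (hd : ∀ a : Fin k → F, a ≠ 0 → d ≤ hammingNorm (Matrix.vecMul a G₀))
    {u : Fin k → F[X]} (hu : u ≠ 0) :
    d ≤ weight (Matrix.vecMul u (perturbedMatrix G₀ w i₀)) := by
  classical
  have hex : ∃ r, ∃ i, (u i).coeff r ≠ 0 := by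
    by_contra! h
    exact hu (funext fun i => Polynomial.ext fun r => by simpa using h r i)
  obtain ⟨i, hi⟩ := Nat.find_spec hex
  set r := Nat.find hex with hr
  have hlow (s : ℕ) (hs : s < r) (i : Fin k) : (u i).coeff s = 0 := by
    by_contra h
    exact Nat.find_min hex hs ⟨i, h⟩
  have hcoeff (j : Fin n) : (Matrix.vecMul u (perturbedMatrix G₀ w i₀) j).coeff r =
      Matrix.vecMul (fun i => (u i).coeff r) G₀ j := by
    -- The `w D` term reaches degree `r` only through coefficient `r - 1` of `u i₀`, which vanishes
    -- by minimality of `r`.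
    have hshift : (u i₀ * C (w j) * X).coeff r = 0 := by
      rcases Nat.eq_zero_or_pos r with h | h
      · rw [h, coeff_mul_X_zero]
      · obtain ⟨s, hs⟩ := Nat.exists_eq_add_of_lt h
        rw [hs, zero_add, coeff_mul_X, coeff_mul_C, hlow s (by omega), zero_mul]
    rw [vecMul_perturbedMatrix_apply, coeff_add, hshift, add_zero, finsetSum_coeff]
    simp [Matrix.vecMul, dotProduct]
  refine (hd (fun i => (u i).coeff r) (Function.ne_iff.mpr ⟨i, hi⟩)).trans ?_
  rw [hammingNorm, Finset.card_filter, weight]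
  refine Finset.sum_le_sum fun j _ => ?_
  split_ifs with h
  · rw [← hcoeff] at h
    exact Finset.card_pos.mpr ⟨r, mem_support_iff.mpr h⟩
  · exact Nat.zero_le _

/-- A linear block code of dimension at least `k`, where `0 < k < n`, and minimum distance at
least `d` gives a convolutional code of dimension `k`, degree one and free distance at least
`d`. -/
theorem exists_hasParameters_of_blockCode [DecidableEq F] (B : Submodule F (Fin n → F))
    (hk : 0 < k) (hkn : k < n) (hB : k ≤ Module.finrank F B) {d : ℕ}
    (hd : ∀ c ∈ B, c ≠ 0 → d ≤ hammingNorm c) :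
    ∃ (C : Submodule F[X] (Fin n → F[X])) (e : ℕ), HasParameters C k 1 1 e ∧ d ≤ e := by
  obtain ⟨f, hf⟩ := exists_linearIndependent_of_le_finrank hB
  let G₀ : Matrix (Fin k) (Fin n) F := Matrix.of fun i => (f i : Fin n → F)
  have hinj : Function.Injective G₀.vecMul :=
    Matrix.vecMul_injective_iff.mpr (hf.map' B.subtype B.ker_subtype)
  obtain ⟨φ, hφ⟩ := G₀.vecMulLinear.exists_leftInverse_of_injective
    (LinearMap.ker_eq_bot.mpr hinj)
  have hφK (v : Fin n → F) : Matrix.vecMul v (LinearMap.toMatrixRight' φ) = φ v := by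
    exact LinearMap.congr_fun (LinearMap.toMatrixRight'.symm_apply_apply φ) v
  have hK : G₀ * LinearMap.toMatrixRight' φ = 1 := by
    refine Matrix.ext_of_single_vecMul fun i => ?_
    rw [← Matrix.vecMul_vecMul, hφK, Matrix.vecMul_one]
    exact LinearMap.congr_fun hφ _
  obtain ⟨w, hw, hw0⟩ := Submodule.exists_mem_ne_zero_of_ne_bot
    (φ.ker_ne_bot_of_finrank_lt (by simpa using hkn))
  have hwK : Matrix.vecMul w (LinearMap.toMatrixRight' φ) = 0 := by rw [hφK]; exact hw
  have hdist (a : Fin k → F) (ha : a ≠ 0) : d ≤ hammingNorm (Matrix.vecMul a G₀) := by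
    refine hd _ ?_ fun h => ha (hinj (h.trans (Matrix.zero_vecMul G₀).symm))
    rw [Matrix.vecMul_eq_sum]
    exact B.sum_mem fun i _ => B.smul_mem _ (f i).2
  let i₀ : Fin k := ⟨0, hk⟩
  let G := perturbedMatrix G₀ w i₀
  have hmemory : memory G = 1 := by
    apply le_antisymm
    · refine Finset.sup_le fun i _ => ?_
      rw [rowDegree_perturbedMatrix hw0]
      split_ifs <;> omega
    · refine le_trans ?_ (Finset.le_sup (Finset.mem_univ i₀))
      rw [rowDegree_perturbedMatrix hw0, if_pos rfl]
  refine ⟨generatedCode G, _, ⟨⟨G, isReducedBasic_perturbedMatrix hw0 i₀ hK hwK, rfl,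
    by simp [G, constraintLength, rowDegree_perturbedMatrix hw0], hmemory⟩, rfl⟩, ?_⟩
  -- Over the empty set `sInf` would be `0`, so a nonzero codeword is needed.
  have hne : {m | ∃ v ∈ generatedCode G, v ≠ 0 ∧ weight v = m}.Nonempty := by
    obtain ⟨j, hj⟩ := Function.ne_iff.mp hw0
    refine ⟨_, Matrix.vecMul (Pi.single i₀ 1) G, ⟨_, rfl⟩, fun h => hj ?_, rfl⟩
    have := congrArg (fun p : F[X] => p.coeff 1) (congrFun h j)
    simpa [G, perturbedMatrix, coeff_C] using this
  obtain ⟨v, ⟨u, rfl⟩, hv0, hv⟩ := Nat.sInf_mem hne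
  rw [freeDistance, ← hv]
  refine le_weight_vecMul_perturbedMatrix hdist ?_
  rintro rfl
  exact hv0 (map_zero _)

end Construction

/-! ### BCH bound and dimension -/

section BCH

variable {F K ι : Type*} [Field F] [Field K] [Algebra F K] [Fintype ι]

/-- A nonzero word whose first `m` power sums at distinct locators vanish has weight more than
`m`. -/
theorem lt_hammingNorm_of_sum_smul_pow_eq_zero [DecidableEq F] {x : ι → K}
    (hx : Function.Injective x) {c : ι → F} (hc : c ≠ 0) {m : ℕ}
    (h : ∀ e < m, ∑ i, c i • x i ^ e = 0) : m < hammingNorm c := by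
  classical
  by_contra! hle
  obtain ⟨i₀, hi₀⟩ := Function.ne_iff.mp hc
  have hmem : i₀ ∈ Finset.univ.filter fun i => c i ≠ 0 := by simpa using hi₀
  let S := (Finset.univ.filter fun i => c i ≠ 0).erase i₀
  -- `P` vanishes on the support of `c` except at `x i₀`, and its degree is below `m`; hence `∑ c i
  -- • P (x i)` is both zero and the single nonzero term at `i₀`.
  let P : K[X] := ∏ i ∈ S, (X - C (x i))
  have hP : P.natDegree < m := by
    rw [natDegree_finsetProd_X_sub_C_eq_card, Finset.card_erase_of_mem hmem]
    have : 0 < (Finset.univ.filter fun i => c i ≠ 0).card := Finset.card_pos.mpr ⟨i₀, hmem⟩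
    rw [hammingNorm] at hle
    omega
  have hsum : ∑ i, c i • P.eval (x i) = 0 := by
    simp_rw [eval_eq_sum_range' hP, Finset.smul_sum]
    rw [Finset.sum_comm]
    refine Finset.sum_eq_zero fun e he => ?_
    simp_rw [← mul_smul_comm]
    rw [← Finset.mul_sum, h e (Finset.mem_range.mp he), mul_zero]
  rw [Finset.sum_eq_single i₀] at hsum
  · refine smul_ne_zero hi₀ ?_ hsum
    rw [eval_prod, Finset.prod_ne_zero_iff]
    intro i hi
    simpa [sub_eq_zero] using fun h => (Finset.mem_erase.mp hi).1 (hx h).symm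
  · intro i _ hi
    by_cases hci : c i = 0
    · rw [hci, zero_smul]
    · have hiS : i ∈ S := Finset.mem_erase.mpr ⟨hi, by simpa using hci⟩
      rw [eval_prod, Finset.prod_eq_zero hiS (by simp), smul_zero]
  · simp

theorem sum_smul_pow_card_eq_zero [Fintype F] {x : ι → K} {c : ι → F}
    (h : ∑ i, c i • x i = 0) : ∑ i, c i • x i ^ Fintype.card F = 0 := by
  have := congrArg (FiniteField.frobeniusAlgHom F K) h
  simpa only [map_sum, map_smul, map_zero, FiniteField.coe_frobeniusAlgHom] using this

variable (F) in
/-- The syndromes `∑ cᵢ` and `∑ cᵢ xᵢ ^ e` for `1 ≤ e ≤ m`. -/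
def syndrome (x : ι → K) (m : ℕ) : (ι → F) →ₗ[F] F × (Fin m → K) :=
  LinearMap.prod (∑ i, LinearMap.proj i)
    (LinearMap.pi fun e => ∑ i, (LinearMap.proj i).smulRight (x i ^ (e.val + 1)))

theorem card_add_two_le_hammingNorm [Fintype F] [DecidableEq F] {x : ι → K}
    (hx : Function.Injective x) {c : ι → F}
    (hmem : c ∈ LinearMap.ker (syndrome F x (Fintype.card F - 1))) (hc : c ≠ 0) :
    Fintype.card F + 2 ≤ hammingNorm c := by
  refine lt_hammingNorm_of_sum_smul_pow_eq_zero hx hc fun e he => ?_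
  have hcard : 1 < Fintype.card F := Fintype.one_lt_card
  obtain ⟨hzero, hpow⟩ := Prod.ext_iff.mp (LinearMap.mem_ker.mp hmem)
  have hpos (e : ℕ) (he : e < Fintype.card F - 1) : ∑ i, c i • x i ^ (e + 1) = 0 := by
    simpa [syndrome] using congrFun hpow ⟨e, he⟩
  rcases Nat.eq_zero_or_pos e with rfl | he0
  · have hsum : ∑ i, c i = 0 := by simpa [syndrome] using hzero
    simp_rw [pow_zero, ← Finset.sum_smul, hsum, zero_smul]
  -- Exponent `q` is not among the syndromes; it is the Frobenius image of exponent `1`.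
  · rcases eq_or_ne e (Fintype.card F) with rfl | hne
    · exact sum_smul_pow_card_eq_zero (by simpa using hpos 0 (by omega))
    · obtain ⟨s, rfl⟩ := Nat.exists_eq_succ_of_ne_zero he0.ne'
      exact hpos s (by omega)

theorem card_le_finrank_ker_syndrome [FiniteDimensional F K] (x : ι → K) (m : ℕ) :
    Fintype.card ι ≤
      Module.finrank F (LinearMap.ker (syndrome F x m)) + (1 + m * Module.finrank F K) := by
  have hrank := (syndrome F x m).finrank_range_add_finrank_ker
  have hle := (LinearMap.range (syndrome F x m)).finrank_le
  rw [Module.finrank_prod, Module.finrank_self, Module.finrank_pi_fintype] at hle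
  simp only [Finset.sum_const, Finset.card_univ, Fintype.card_fin, smul_eq_mul] at hle
  rw [Module.finrank_fintype_fun_eq_card] at hrank
  omega

end BCH

end ConvCode

theorem mainTheorem9 (q : ℕ) (hq : IsPrimePow q) (hq4 : 4 ≤ q) (n : ℕ) (hn : n = q ^ 2 - 1)
    (F : Type*) [Field F] [Fintype F] (hF : Fintype.card F = q) :
    ∃ (C : Submodule (Polynomial F) (Fin n → Polynomial F)) (d : ℕ),
      ConvCode.HasParameters C (n - 2 * q + 1) 1 1 d ∧ q + 2 ≤ d := by
  classical
  obtain ⟨p, _⟩ := CharP.exists F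
  have : Fact p.Prime := ⟨CharP.char_is_prime F p⟩
  let K := FiniteField.Extension F p 2
  have : Finite K := Module.finite_of_finite F
  have : Fintype K := Fintype.ofFinite K
  have hK : Fintype.card Kˣ = n := by
    rw [Fintype.card_units, ← Nat.card_eq_fintype_card, FiniteField.natCard_extension,
      Nat.card_eq_fintype_card, hF, hn]
  let x : Fin n → K := fun i => ((Fintype.equivFinOfCardEq hK).symm i : K)
  have hx : Function.Injective x :=
    Units.val_injective.comp (Fintype.equivFinOfCardEq hK).symm.injective
  have hdim := ConvCode.card_le_finrank_ker_syndrome (F := F) x (Fintype.card F - 1)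
  rw [FiniteField.finrank_extension, Fintype.card_fin, hF] at hdim
  have hlarge : 2 * q ≤ n := by
    have : 4 * q ≤ q ^ 2 := by rw [sq]; exact Nat.mul_le_mul_right q hq4
    omega
  exact ConvCode.exists_hasParameters_of_blockCode
    (LinearMap.ker (ConvCode.syndrome F x (q - 1))) (by omega) (by omega) (by omega)
    fun c hc hc0 => by
      rw [← hF] at hc ⊢
      exact ConvCode.card_add_two_le_hammingNorm hx hc hc0
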